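/- All graphs are finite and simple. Let $K_4^-$ be the graph obtained from $K_4$ by deleting one edge. A graph $G$ is $K_4^-$-saturated if $G$ contains no (not necessarily induced) copy of $K_4^-$, but adding any edge between two distinct non-adjacent vertices of $G$ creates a copy of $K_4^-$. Let $ES(n,K_4^-)$ be the set of all possible numbers of edges of $K_4^-$-saturated graphs on $n$ vertices. Write $[s,t]$ for the set of integers $k$ with $s\le k\le t$. (a) Let $n\neq 6$. If $G$ is a $K_4^-$-saturated graph with $n$ vertices and more than $\left\lfloor\frac{n-1}{2}\right\rfloor\left\lceil\frac{n-1}{2}\right\rceil+2$ edges, then $G$ is bipartite. (b) For every $n\ge 10$ and every integer $m\in\left[3n-11,\ \left\lfloor\frac{n-1}{2}\right\rfloor\left\lceil\frac{n-1}{2}\right\rceil+2\right]$ there is a non-bipartite $K_4^-$-saturated graph with $n$ vertices and $m$ edges. (c) For every $n\ge 10$, $$ES(n,K_4^-)=\left\{\left\lfloor \tfrac{3(n-1)}{2}\right\rfloor\right\}\cup\left[2n-4,\ \left\lfloor\tfrac{n-1}{2}\right\rfloor\left\lceil\tfrac{n-1}{2}\right\rceil+2\right]\cup\{\,i(n-i)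 : i\in[2,n-2]\,\}.$$ -/

import Mathlib

/-- `K₄⁻`: the complete graph on four vertices with one edge deleted. -/
def K4Minus : SimpleGraph (Fin 4) :=
  (⊤ : SimpleGraph (Fin 4)).deleteEdges {s(0, 1)}

/-- `G` is `H`-saturated: `G` contains no copy of `H` (as a not necessarily induced subgraph), but
adding any edge between two distinct non-adjacent vertices of `G` creates a copy of `H`. -/
def IsSaturated {V W : Type*} (H : SimpleGraph W) (G : SimpleGraph V) : Prop :=
  H.Free G ∧ ∀ u v : V, u ≠ v → ¬ G.Adj u v → H.IsContained (G ⊔ SimpleGraph.edge u v)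

/-- The edge spectrum `ES(n, H)`: the set of all sizes (numbers of edges) of `H`-saturated graphs
on `n` vertices. -/
def edgeSpectrum {W : Type*} (n : ℕ) (H : SimpleGraph W) : Set ℕ :=
  {m | ∃ G : SimpleGraph (Fin n), IsSaturated H G ∧ G.edgeSet.ncard = m}

/-! Saturation amounts to two local conditions: every edge lies in at most one triangle
(`DiamondFree`), and any two non-adjacent vertices are `DiamondLinked`, so in particular have a
common neighbour.

Upper bound: a non-bipartite saturated graph contains a triangle or a 5-cycle. A vertex outside a
triangle has at most one neighbour in it, and in a triangle-free graph a vertex outside a 5-cycle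
has at most two on it. A Mantel bound on the remaining vertices gives at most `((n - 1) ^ 2 + 8) /
4` edges. Bipartite saturated graphs are complete bipartite with both parts of size at least 2.

Lower bound: a dominating vertex forces a near-perfect matching on the other vertices, hence exactly
`3 * (n - 1) / 2` edges. Otherwise there are at least `2 * n - 4`, by cases on the minimum degree
(`le_card_edges_of_not_dominating`).

Constructions are blow-ups of small patterns, whose saturation is a decidable condition on vertex
types (`BlowupPattern.exists_isSaturated`). -/

section

open Finset

namespace SimpleGraph

variable {V : Type*} {G : SimpleGraph V}

/-! ### Local form of saturation. -/

theorem k4Minus_isContained_iff : K4Minus.IsContained G ↔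
    ∃ a b c d, a ≠ b ∧ G.Adj c d ∧ G.Adj a c ∧ G.Adj a d ∧ G.Adj b c ∧ G.Adj b d := by
  constructor
  · rintro ⟨f⟩
    have h : ∀ i j, K4Minus.Adj i j → G.Adj (f i) (f j) := fun i j hij => f.toHom.map_adj hij
    refine ⟨f 0, f 1, f 2, f 3, fun e => ?_, h _ _ ?_, h _ _ ?_, h _ _ ?_, h _ _ ?_, h _ _ ?_⟩
    · exact absurd (f.injective e) (by decide)
    all_goals simp [K4Minus]
  · rintro ⟨a, b, c, d, hab, hcd, hac, had, hbc, hbd⟩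
    refine ⟨⟨⟨![a, b, c, d], ?_⟩, ?_⟩⟩
    · intro i j hij
      fin_cases i <;> fin_cases j <;>
        simp_all [K4Minus, hcd.symm, hac.symm, had.symm, hbc.symm, hbd.symm]
    · have := hcd.ne; have := hac.ne; have := had.ne; have := hbc.ne; have := hbd.ne
      intro i j hij
      fin_cases i <;> fin_cases j <;> simp_all [eq_comm]

/-- Every edge lies in at most one triangle. -/
def DiamondFree (G : SimpleGraph V) : Prop :=
  ∀ ⦃a b c d⦄, G.Adj c d → G.Adj a c → G.Adj a d → G.Adj b c → G.Adj b d → a = b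

/-- `u` and `v` have two common neighbours, or a common neighbour `w` such that `uw` or `vw` lies
in a triangle. -/
def DiamondLinked (G : SimpleGraph V) (u v : V) : Prop :=
  ∃ w x, G.Adj u w ∧ G.Adj v w ∧ w ≠ x ∧
    (G.Adj u x ∧ G.Adj v x ∨ G.Adj w x ∧ G.Adj u x ∨ G.Adj w x ∧ G.Adj v x)

theorem free_k4Minus_iff : K4Minus.Free G ↔ G.DiamondFree := by
  rw [SimpleGraph.Free, k4Minus_isContained_iff]
  constructor
  · intro h a b c d h1 h2 h3 h4 h5
    by_contra hab
    exact h ⟨a, b, c, d, hab, h1, h2, h3, h4, h5⟩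
  · rintro h ⟨a, b, c, d, hab, h1, h2, h3, h4, h5⟩
    exact hab (h h1 h2 h3 h4 h5)

theorem isContained_sup_edge_iff (hG : G.DiamondFree) {u v : V} (huv : u ≠ v)
    (hn : ¬ G.Adj u v) : K4Minus.IsContained (G ⊔ edge u v) ↔ G.DiamondLinked u v := by
  rw [k4Minus_isContained_iff]
  have key : ∀ x y, (G ⊔ edge u v).Adj x y ↔ G.Adj x y ∨ (x = u ∧ y = v) ∨ (x = v ∧ y = u) := by
    intro x y
    simp only [sup_adj, edge_adj]
    grind
  constructor
  · rintro ⟨a, b, c, d, hab, h1, h2, h3, h4, h5⟩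
    have hca := h1.ne; have h2n := h2.ne; have h3n := h3.ne; have h4n := h4.ne; have h5n := h5.ne
    rw [key] at h1 h2 h3 h4 h5
    have := hG (a := a) (b := b) (c := c) (d := d)
    have hs : ∀ x y, G.Adj x y → G.Adj y x := fun _ _ h => h.symm
    unfold DiamondLinked
    rcases h1 with h1 | h1
    · rcases h2 with h2 | h2
      · rcases h3 with h3 | h3
        · rcases h4 with h4 | h4
          · have h5 : (b = u ∧ d = v) ∨ b = v ∧ d = u := by tauto
            refine ⟨c, a, ?_⟩
            grind
          · refine ⟨d, a, ?_⟩
            grind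
        · refine ⟨c, b, ?_⟩
          grind
      · refine ⟨d, b, ?_⟩
        grind
    · refine ⟨a, b, ?_⟩
      grind
  · rintro ⟨w, x, h1, h2, hwx, h | h | h⟩
    · exact ⟨w, x, u, v, hwx, by simp [key], by simp [key, h1.symm], by simp [key, h2.symm],
        by simp [key, h.1.symm], by simp [key, h.2.symm]⟩
    · refine ⟨v, x, u, w, fun e => hn (e ▸ h.2), ?_⟩
      simp [key, h1, h2, h.1.symm, h.2.symm]
    · refine ⟨u, x, v, w, fun e => hn (e ▸ h.2.symm), ?_⟩
      simp [key, h1, h2, h.1.symm, h.2.symm]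

theorem isSaturated_k4Minus_iff : IsSaturated K4Minus G ↔
    G.DiamondFree ∧ ∀ u v, u ≠ v → ¬ G.Adj u v → G.DiamondLinked u v := by
  rw [IsSaturated, free_k4Minus_iff]
  refine and_congr_right fun h => forall_congr' fun u => forall_congr' fun v =>
    forall_congr' fun huv => forall_congr' fun hn => isContained_sup_edge_iff h huv hn


/-! ### Counting adjacent pairs; upper bounds. -/

open Classical in
/-- The number of ordered pairs in `A × B` that are adjacent in `G`. -/
noncomputable def adjCount (G : SimpleGraph V) (A B : Finset V) : ℕ :=
  ∑ a ∈ A, ∑ b ∈ B, if G.Adj a b then 1 else 0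

theorem adjCount_comm (A B : Finset V) : G.adjCount A B = G.adjCount B A := by
  rw [adjCount, sum_comm, adjCount]
  exact sum_congr rfl fun a _ => sum_congr rfl fun b _ => by rw [G.adj_comm]

theorem adjCount_disjUnion_left [DecidableEq V] {A B : Finset V} (h : Disjoint A B)
    (C : Finset V) : G.adjCount (A ∪ B) C = G.adjCount A C + G.adjCount B C := by
  rw [adjCount, sum_union h]; rfl

theorem adjCount_disjUnion_right [DecidableEq V] {A B : Finset V} (h : Disjoint A B)
    (C : Finset V) : G.adjCount C (A ∪ B) = G.adjCount C A + G.adjCount C B := by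
  rw [adjCount_comm, adjCount_disjUnion_left h, adjCount_comm A, adjCount_comm B]

theorem adjCount_disjUnion_self [DecidableEq V] {A B : Finset V} (h : Disjoint A B) :
    G.adjCount (A ∪ B) (A ∪ B) = G.adjCount A A + 2 * G.adjCount B A + G.adjCount B B := by
  rw [adjCount_disjUnion_left h, adjCount_disjUnion_right h, adjCount_disjUnion_right h,
    adjCount_comm A B]
  ring

theorem adjCount_eq_sum (A B : Finset V) :
    G.adjCount A B = ∑ a ∈ A, G.adjCount {a} B := by
  simp [adjCount]

open Classical in
theorem adjCount_singleton (a : V) (B : Finset V) :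
    G.adjCount {a} B = #{b ∈ B | G.Adj a b} := by
  simp [adjCount]

theorem adjCount_univ [Fintype V] : G.adjCount univ univ = 2 * G.edgeSet.ncard := by
  classical
  rw [← coe_edgeFinset, Set.ncard_coe_finset, ← sum_degrees_eq_twice_card_edges, adjCount_eq_sum]
  refine sum_congr rfl fun v _ => ?_
  rw [adjCount_singleton, ← card_neighborFinset_eq_degree]
  congr 1
  ext; simp

theorem adjCount_le_mul {A B : Finset V} {k : ℕ} (h : ∀ a ∈ A, G.adjCount {a} B ≤ k) :
    G.adjCount A B ≤ k * #A := by
  rw [adjCount_eq_sum, mul_comm]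
  simpa using sum_le_card_nsmul A _ k h

theorem mul_le_adjCount {A B : Finset V} {k : ℕ} (h : ∀ a ∈ A, k ≤ G.adjCount {a} B) :
    k * #A ≤ G.adjCount A B := by
  rw [adjCount_eq_sum, mul_comm]
  simpa using card_nsmul_le_sum A _ k h

theorem even_adjCount_self (A : Finset V) : Even (G.adjCount A A) := by
  classical
  induction A using Finset.induction_on with
  | empty => simp [adjCount]
  | insert a A ha ih =>
    rw [insert_eq, adjCount_disjUnion_self (by simpa using ha)]
    have : G.adjCount {a} {a} = 0 := by simp [adjCount]
    rw [this, zero_add]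
    exact (even_two_mul _).add ih

theorem adjCount_self_eq_zero {A : Finset V} (h : ∀ a ∈ A, ∀ b ∈ A, ¬ G.Adj a b) :
    G.adjCount A A = 0 := by
  rw [adjCount]
  exact sum_eq_zero fun a ha => sum_eq_zero fun b hb => if_neg (h a ha b hb)

/-- The Mantel bound for the subgraph induced on a finset. -/
theorem two_mul_adjCount_le_sq (S : Finset V)
    (h : ∀ a ∈ S, ∀ b ∈ S, ∀ c ∈ S, G.Adj a b → G.Adj a c → ¬ G.Adj b c) :
    2 * G.adjCount S S ≤ #S ^ 2 := by
  classical
  induction hs : #S using Nat.strong_induction_on generalizing S with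
  | _ s ih =>
  by_cases he : ∀ a ∈ S, ∀ b ∈ S, ¬ G.Adj a b
  · simp [adjCount_self_eq_zero he]
  push Not at he
  obtain ⟨a, ha, b, hb, hab⟩ := he
  have hsub : ({a, b} : Finset V) ⊆ S := by simp [insert_subset_iff, ha, hb]
  have hc2 : #({a, b} : Finset V) = 2 := card_pair hab.ne
  -- Delete the adjacent pair: in the absence of triangles every other vertex sees at most one of
  -- its ends.
  obtain ⟨r, hr⟩ : ∃ r, s = r + 2 := ⟨s - 2, by have := card_le_card hsub; omega⟩
  have hc : #(S \ {a, b}) = r := by rw [card_sdiff_of_subset hsub]; omega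
  have h1 := ih r (by omega) (S \ {a, b})
    (fun x hx y hy z hz => h x (mem_sdiff.1 hx).1 y (mem_sdiff.1 hy).1 z (mem_sdiff.1 hz).1) hc
  have h2 : G.adjCount (S \ {a, b}) {a, b} ≤ 1 * r := by
    rw [← hc]
    refine adjCount_le_mul fun x hx => ?_
    have := h x (mem_sdiff.1 hx).1 a ha b hb
    simp only [adjCount, sum_singleton, sum_pair hab.ne]
    split_ifs <;> simp_all
  have h3 : G.adjCount {a, b} {a, b} = 2 := by
    simp [adjCount, sum_pair hab.ne, hab, hab.symm]
  have := adjCount_disjUnion_self (G := G) (A := {a, b}) (B := S \ {a, b}) disjoint_sdiff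
  rw [union_sdiff_of_subset hsub] at this
  rw [this, hr]
  nlinarith

/-- A vertex adjacent to two corners would put a second triangle on the edge between them. -/
theorem adjCount_sdiff_triangle_le [DecidableEq V] (hG : G.DiamondFree) {a b c : V}
    (hab : G.Adj a b) (hac : G.Adj a c) (hbc : G.Adj b c) (S : Finset V) :
    G.adjCount (S \ {a, b, c}) {a, b, c} ≤ #(S \ {a, b, c}) := by
  rw [← one_mul #(_ \ _)]
  refine adjCount_le_mul fun x hx => ?_
  have hxn : x ≠ a ∧ x ≠ b ∧ x ≠ c := by simpa using (mem_sdiff.1 hx).2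
  have h1 := fun h h' => hxn.2.2 (hG (a := x) (b := c) hab h h' hac.symm hbc.symm)
  have h2 := fun h h' => hxn.2.1 (hG (a := x) (b := b) hac h h' hab.symm hbc)
  have h3 := fun h h' => hxn.1 (hG (a := x) (b := a) hbc h h' hab hac)
  have hn : a ∉ ({b, c} : Finset V) := by simp [hab.ne, hac.ne]
  simp only [adjCount, sum_singleton, sum_insert hn, sum_pair hbc.ne]
  split_ifs <;> simp_all

theorem adjCount_triangle [DecidableEq V] {a b c : V}
    (hab : G.Adj a b) (hac : G.Adj a c) (hbc : G.Adj b c) :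
    G.adjCount {a, b, c} {a, b, c} = 6 := by
  have hn : a ∉ ({b, c} : Finset V) := by simp [hab.ne, hac.ne]
  simp [adjCount, sum_insert hn, sum_pair hbc.ne, hab, hac, hbc, hab.symm, hac.symm, hbc.symm]

theorem adjCount_self_le_of_triangle [DecidableEq V] (hG : G.DiamondFree) {a b c : V}
    (hab : G.Adj a b) (hac : G.Adj a c) (hbc : G.Adj b c) {S : Finset V} (hS : {a, b, c} ⊆ S) :
    G.adjCount S S ≤ 2 * #S + G.adjCount (S \ {a, b, c}) (S \ {a, b, c}) ∧
      #(S \ {a, b, c}) + 3 = #S := by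
  have hc3 : #({a, b, c} : Finset V) = 3 := card_eq_three.2 ⟨a, b, c, hab.ne, hac.ne, hbc.ne, rfl⟩
  have h0 := card_le_card hS
  have h1 := card_sdiff_of_subset hS
  have h2 := adjCount_sdiff_triangle_le hG hab hac hbc S
  have h3 := adjCount_triangle hab hac hbc
  have := adjCount_disjUnion_self (G := G) (A := {a, b, c}) (B := S \ {a, b, c}) disjoint_sdiff
  rw [union_sdiff_of_subset hS] at this
  omega

/-- A diamond-free graph on `s ≠ 3` vertices has at most `s² / 4` edges. -/
theorem DiamondFree.two_mul_adjCount_le_sq (hG : G.DiamondFree) (S : Finset V) (h3 : #S ≠ 3) :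
    2 * G.adjCount S S ≤ #S ^ 2 := by
  classical
  induction hs : #S using Nat.strong_induction_on generalizing S with
  | _ s ih =>
  by_cases ht : ∀ a ∈ S, ∀ b ∈ S, ∀ c ∈ S, G.Adj a b → G.Adj a c → ¬ G.Adj b c
  · exact hs ▸ SimpleGraph.two_mul_adjCount_le_sq S ht
  push Not at ht
  obtain ⟨a, ha, b, hb, c, hc, hab, hac, hbc⟩ := ht
  obtain ⟨h1, h2⟩ := adjCount_self_le_of_triangle hG hab hac hbc (S := S)
    (by simp [insert_subset_iff, ha, hb, hc])
  -- The induction hypothesis fails on three vertices, since a triangle exceeds the bound; for six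
  -- vertices the trivial degree bound 2 on the remainder suffices, with equality.
  by_cases h6 : #(S \ {a, b, c}) = 3
  · have h4 : G.adjCount (S \ {a, b, c}) (S \ {a, b, c}) ≤ 2 * #(S \ {a, b, c}) := by
      refine adjCount_le_mul fun x hx => ?_
      rw [adjCount_singleton]
      calc _ ≤ #((S \ {a, b, c}).erase x) := card_le_card fun y => by
            simp only [mem_filter, mem_erase]
            exact fun h => ⟨h.2.ne', h.1⟩
        _ = 2 := by rw [card_erase_of_mem hx]; omega
    obtain rfl : s = 6 := by omega
    omega
  · have h4 := ih #(S \ {a, b, c}) (by omega) (S \ {a, b, c}) h6 rfl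
    set r := #(S \ {a, b, c})
    obtain rfl : s = r + 3 := by omega
    rcases Nat.lt_or_ge r 2 with hr | hr
    · interval_cases r <;> omega
    · nlinarith

section Fintype

variable [Fintype V]

theorem four_mul_card_edges_le_of_triangle (hG : G.DiamondFree) {a b c : V}
    (hab : G.Adj a b) (hac : G.Adj a c) (hbc : G.Adj b c) (hn : Fintype.card V ≠ 6) :
    4 * G.edgeSet.ncard ≤ (Fintype.card V - 1) ^ 2 + 8 := by
  classical
  obtain ⟨h1, h2⟩ := adjCount_self_le_of_triangle hG hab hac hbc (subset_univ _)
  rw [adjCount_univ] at h1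
  rw [card_univ] at h1 h2
  -- The order 6 is excluded because the remainder must not have three vertices.
  have h4 := hG.two_mul_adjCount_le_sq (univ \ {a, b, c}) (by omega)
  set r := #(univ \ {a, b, c})
  rw [← h2] at h1 ⊢
  rw [Nat.add_sub_assoc (by simp)]
  nlinarith

theorem four_mul_card_edges_le_of_pentagon (hG : ∀ a b c, G.Adj a b → G.Adj a c → ¬ G.Adj b c)
    {a b c d e : V} (hac : a ≠ c) (had : a ≠ d) (hbd : b ≠ d) (hbe : b ≠ e) (hce : c ≠ e)
    (hab : G.Adj a b) (hbc : G.Adj b c) (hcd : G.Adj c d) (hde : G.Adj d e) (hea : G.Adj e a) :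
    4 * G.edgeSet.ncard ≤ (Fintype.card V - 1) ^ 2 + 8 := by
  classical
  set C : Finset V := {a, b, c, d, e} with hC
  have hna : a ∉ ({b, c, d, e} : Finset V) := by simp [hab.ne, hac, had, hea.ne']
  have hnb : b ∉ ({c, d, e} : Finset V) := by simp [hbc.ne, hbd, hbe]
  have hnc : c ∉ ({d, e} : Finset V) := by simp [hcd.ne, hce]
  have hcard : #C = 5 := by
    rw [hC, card_insert_of_notMem hna, card_insert_of_notMem hnb, card_insert_of_notMem hnc,
      card_pair hde.ne]
  have h1 := two_mul_adjCount_le_sq C fun a _ b _ c _ => hG a b c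
  obtain ⟨m, hm⟩ := even_adjCount_self (G := G) C
  have h2 := two_mul_adjCount_le_sq (univ \ C) fun a _ b _ c _ => hG a b c
  have h3 : G.adjCount (univ \ C) C ≤ 2 * #(univ \ C) := by
    refine adjCount_le_mul fun x hx => ?_
    have g1 := fun h h' => hG x a b h h' hab
    have g2 := fun h h' => hG x b c h h' hbc
    have g3 := fun h h' => hG x c d h h' hcd
    have g4 := fun h h' => hG x d e h h' hde
    have g5 := fun h h' => hG x e a h h' hea
    simp only [hC, adjCount, sum_singleton, sum_insert hna, sum_insert hnb, sum_insert hnc,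
      sum_pair hde.ne]
    split_ifs <;> simp_all
  have h4 := card_sdiff_of_subset (subset_univ C)
  have h5 := card_le_card (subset_univ C)
  have h6 := adjCount_disjUnion_self (G := G) (A := C) (B := univ \ C) disjoint_sdiff
  rw [union_sdiff_of_subset (subset_univ C), adjCount_univ] at h6
  rw [card_univ] at h4 h5
  set r := #(univ \ C)
  rw [hcard] at h1
  obtain ⟨k, hk⟩ : ∃ k, Fintype.card V = r + 5 := ⟨0, by omega⟩
  rw [hk, Nat.add_sub_assoc (by simp)]
  -- Mantel allows 6 edges on the five vertices; this crude value already yields the constant 8.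
  have : m ≤ 6 := by omega
  nlinarith

end Fintype

/-- A triangle-free diamond-linked graph without a 5-cycle is bipartite. -/
theorem isBipartite_or_triangle_or_pentagon
    (hS : ∀ u v, u ≠ v → ¬ G.Adj u v → G.DiamondLinked u v) :
    G.IsBipartite ∨ (∃ a b c, G.Adj a b ∧ G.Adj a c ∧ G.Adj b c) ∨
      ∃ a b c d e, a ≠ c ∧ a ≠ d ∧ b ≠ d ∧ b ≠ e ∧ c ≠ e ∧
        G.Adj a b ∧ G.Adj b c ∧ G.Adj c d ∧ G.Adj d e ∧ G.Adj e a := by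
  classical
  by_cases ht : ∃ a b c, G.Adj a b ∧ G.Adj a c ∧ G.Adj b c
  · exact .inr (.inl ht)
  rw [or_iff_right ht]
  rcases isEmpty_or_nonempty V with hV | ⟨⟨v⟩⟩
  · exact .inl (.of_isEmpty 2)
  -- Colour by adjacency to `v`. An edge inside the neighbourhood gives a triangle; an edge outside
  -- it closes to a 5-cycle through common neighbours of its ends with `v`.
  by_cases hp : ∃ x y, G.Adj x y ∧ ¬ G.Adj v x ∧ ¬ G.Adj v y
  · obtain ⟨x, y, hxy, hx, hy⟩ := hp
    have hvx : v ≠ x := by rintro rfl; exact hy hxy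
    have hvy : v ≠ y := by rintro rfl; exact hx hxy.symm
    obtain ⟨p, -, hp, hp', -⟩ := hS v x hvx hx
    obtain ⟨q, -, hq, hq', -⟩ := hS v y hvy hy
    right
    refine ⟨v, p, x, y, q, hvx, hvy, ?_, ?_, ?_, hp, hp'.symm, hxy, hq', hq.symm⟩
    · rintro rfl; exact hy hp
    · rintro rfl; exact ht ⟨_, _, _, hxy, hp', hq'⟩
    · rintro rfl; exact hx hq
  · push Not at hp ht
    left
    refine ⟨Coloring.mk (fun x => if G.Adj v x then 0 else 1) ?_⟩
    intro x y hxy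
    have h1 := ht v x y
    have h2 := hp x y hxy
    by_cases hx : G.Adj v x <;> by_cases hy : G.Adj v y <;> simp_all

theorem half_mul_ceilHalf (k : ℕ) : k / 2 * (k ⌈/⌉ 2) = k ^ 2 / 4 := by
  rw [Nat.ceilDiv_eq_add_pred_div]
  obtain ⟨m, rfl | rfl⟩ := Nat.even_or_odd' k
  · have h1 : 2 * m / 2 = m := by omega
    have h2 : (2 * m + 2 - 1) / 2 = m := by omega
    rw [h1, h2]
    symm
    apply Nat.div_eq_of_eq_mul_left <;> [norm_num; ring]
  · have h1 : (2 * m + 1) / 2 = m := by omega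
    have h2 : (2 * m + 1 + 2 - 1) / 2 = m + 1 := by omega
    have h3 : (2 * m + 1) ^ 2 = 4 * (m * (m + 1)) + 1 := by ring
    rw [h1, h2, h3]
    omega

theorem isBipartite_of_isSaturated_of_lt [Fintype V] (hG : IsSaturated K4Minus G)
    (hn : Fintype.card V ≠ 6)
    (hlt : ((Fintype.card V - 1) / 2) * ((Fintype.card V - 1) ⌈/⌉ 2) + 2 < G.edgeSet.ncard) :
    G.IsBipartite := by
  obtain ⟨hF, hS⟩ := isSaturated_k4Minus_iff.1 hG
  rw [half_mul_ceilHalf] at hlt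
  by_cases ht : ∃ a b c, G.Adj a b ∧ G.Adj a c ∧ G.Adj b c
  · obtain ⟨a, b, c, hab, hac, hbc⟩ := ht
    have := four_mul_card_edges_le_of_triangle hF hab hac hbc hn
    omega
  rcases isBipartite_or_triangle_or_pentagon hS with h | h | h
  · exact h
  · exact absurd h ht
  · obtain ⟨a, b, c, d, e, h1, h2, h3, h4, h5, h6, h7, h8, h9, h10⟩ := h
    have := four_mul_card_edges_le_of_pentagon (fun a b c h h' h'' => ht ⟨a, b, c, h, h', h''⟩)
      h1 h2 h3 h4 h5 h6 h7 h8 h9 h10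
    omega


/-! ### Lower bounds. -/

theorem DiamondLinked.symm {u v : V} (h : G.DiamondLinked u v) : G.DiamondLinked v u := by
  obtain ⟨w, x, h1, h2, h3, h4⟩ := h
  exact ⟨w, x, h2, h1, h3, by tauto⟩

theorem one_le_adjCount_singleton {a b : V} {B : Finset V} (hb : b ∈ B) (hab : G.Adj a b) :
    1 ≤ G.adjCount {a} B := by
  classical
  rw [adjCount_singleton]
  exact card_pos.2 ⟨b, mem_filter.2 ⟨hb, hab⟩⟩

theorem two_le_adjCount_singleton {a b c : V} {B : Finset V} (hb : b ∈ B) (hc : c ∈ B)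
    (hbc : b ≠ c) (hab : G.Adj a b) (hac : G.Adj a c) : 2 ≤ G.adjCount {a} B := by
  classical
  rw [adjCount_singleton]
  exact one_lt_card.2 ⟨b, mem_filter.2 ⟨hb, hab⟩, c, mem_filter.2 ⟨hc, hac⟩, hbc⟩

theorem three_le_adjCount_singleton {a b c d : V} {B : Finset V} (hb : b ∈ B) (hc : c ∈ B)
    (hd : d ∈ B) (hbc : b ≠ c) (hbd : b ≠ d) (hcd : c ≠ d) (hab : G.Adj a b) (hac : G.Adj a c)
    (had : G.Adj a d) : 3 ≤ G.adjCount {a} B := by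
  classical
  rw [adjCount_singleton]
  exact two_lt_card.2 ⟨b, mem_filter.2 ⟨hb, hab⟩, c, mem_filter.2 ⟨hc, hac⟩, d,
    mem_filter.2 ⟨hd, had⟩, hbc, hbd, hcd⟩

theorem adjCount_univ_induce (S : Finset V) :
    (G.induce (S : Set V)).adjCount univ univ = G.adjCount S S := by
  classical
  unfold adjCount
  rw [← sum_coe_sort S]
  refine sum_congr rfl fun a _ => ?_
  rw [← sum_coe_sort S]
  exact sum_congr rfl fun b _ => by congr 1

theorem dominating_of_neighbors_subset_singleton [Nontrivial V]
    (hS : ∀ u v, u ≠ v → ¬ G.Adj u v → G.DiamondLinked u v) {u v : V}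
    (hu : ∀ w, G.Adj u w → w = v) : ∀ w, w ≠ v → G.Adj v w := by
  have huv : G.Adj u v := by
    obtain ⟨z, hz⟩ := exists_ne u
    by_cases h : G.Adj u z
    · rwa [← hu z h]
    · obtain ⟨p, -, hp, -⟩ := hS u z hz.symm h
      rwa [← hu p hp]
  intro w hw
  by_cases hwu : w = u
  · exact hwu ▸ huv.symm
  · obtain ⟨p, -, hp, hp', -⟩ := hS u w (Ne.symm hwu) fun h => hw (hu w h)
    rw [hu p hp] at hp'
    exact hp'.symm

section Fintype

variable [Fintype V]

theorem two_mul_card_edges_eq [DecidableEq V] (K : Finset V) :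
    2 * G.edgeSet.ncard =
      G.adjCount K K + 2 * G.adjCount (univ \ K) K + G.adjCount (univ \ K) (univ \ K) := by
  rw [← adjCount_univ, ← adjCount_disjUnion_self disjoint_sdiff, union_sdiff_of_subset (subset_univ K)]

/-- Diamond-freeness makes the rest `N` a matching. Two unmatched vertices would share only `v`,
with no triangle on either edge, so at most one is unmatched; parity then fixes the count. -/
theorem card_edges_eq_of_dominating (hF : G.DiamondFree)
    (hS : ∀ u v, u ≠ v → ¬ G.Adj u v → G.DiamondLinked u v) {v : V}
    (hv : ∀ w, w ≠ v → G.Adj v w) :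
    G.edgeSet.ncard = 3 * (Fintype.card V - 1) / 2 := by
  classical
  set N : Finset V := univ \ {v} with hN
  have hmem : ∀ x, x ∈ N ↔ x ≠ v := by simp [hN]
  have h0 := two_mul_card_edges_eq (G := G) {v}
  rw [← hN] at h0
  have h1 : G.adjCount {v} {v} = 0 := by simp [adjCount]
  have h2 : G.adjCount N {v} = #N := by
    rw [adjCount_comm, adjCount_singleton, filter_true_of_mem fun x hx => hv x ((hmem x).1 hx)]
  have h3 : G.adjCount N N ≤ 1 * #N := by
    refine adjCount_le_mul fun x hx => ?_
    rw [adjCount_singleton, card_le_one]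
    intro y hy z hz
    simp only [mem_filter, hmem] at hx hy hz
    exact hF (hv x hx) (hv y hy.1).symm hy.2.symm (hv z hz.1).symm hz.2.symm
  have h4 : #{w ∈ N | G.adjCount {w} N = 0} ≤ 1 := by
    rw [card_le_one]
    intro y hy z hz
    simp only [mem_filter, hmem] at hy hz
    have ky : ∀ x, G.Adj y x → x = v := fun x hx => by
      by_contra hxv
      have := one_le_adjCount_singleton ((hmem x).2 hxv) hx
      omega
    have kz : ∀ x, G.Adj z x → x = v := fun x hx => by
      by_contra hxv
      have := one_le_adjCount_singleton ((hmem x).2 hxv) hx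
      omega
    by_contra hyz
    obtain ⟨p, x, hyp, hzp, hpx, h⟩ := hS y z hyz fun h => hz.1 (ky z h)
    have := ky p hyp
    have : x = v := by
      rcases h with h | h | h
      · exact ky x h.1
      · exact ky x h.2
      · exact kz x h.2
    grind
  have h5 : #N ≤ G.adjCount N N + 1 := by
    rw [← card_filter_add_card_filter_not (s := N) (fun w => G.adjCount {w} N = 0)]
    have : #{w ∈ N | ¬ G.adjCount {w} N = 0} ≤ G.adjCount N N := by
      rw [adjCount_eq_sum, card_filter]
      refine sum_le_sum fun w _ => ?_
      split_ifs <;> omega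
    omega
  obtain ⟨m, hm⟩ := even_adjCount_self (G := G) N
  have h6 : #N = Fintype.card V - 1 := by
    rw [hN, card_sdiff_of_subset (subset_univ _), card_univ, card_singleton]
  omega

/-- Each vertex of `R` sees exactly one of `a`, `b`. Both classes are non-empty, and vertices of
different classes are at distance at most 2 inside `R`, so `R` is connected. The total is at least
`3 + (n - 3) + (n - 4)`. -/
theorem le_card_edges_of_degree_two_of_adj (hF : G.DiamondFree)
    (hS : ∀ u v, u ≠ v → ¬ G.Adj u v → G.DiamondLinked u v)
    (hdom : ∀ v, ∃ w, w ≠ v ∧ ¬ G.Adj v w) {u a b : V}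
    (hu : ∀ w, G.Adj u w ↔ w = a ∨ w = b) (hab : G.Adj a b) :
    2 * Fintype.card V ≤ G.edgeSet.ncard + 4 := by
  classical
  have hua : G.Adj u a := (hu a).2 (.inl rfl)
  have hub : G.Adj u b := (hu b).2 (.inr rfl)
  have h0 := two_mul_card_edges_eq (G := G) {u, a, b}
  rw [adjCount_triangle hua hub hab] at h0
  set R : Finset V := univ \ {u, a, b} with hR
  have hmem : ∀ x, x ∈ R ↔ x ≠ u ∧ x ≠ a ∧ x ≠ b := by simp [hR]
  have hRadj : ∀ x ∈ R, G.Adj x a ∨ G.Adj x b := by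
    intro x hx
    rw [hmem] at hx
    obtain ⟨p, -, hp, hp', -⟩ := hS u x hx.1.symm (by rw [hu]; tauto)
    rcases (hu p).1 hp with rfl | rfl <;> simp [hp']
  have hnot : ∀ x ∈ R, G.Adj x a → ¬ G.Adj x b := fun x hx hxa hxb =>
    ((hmem x).1 hx).1 (hF hab hxa hxb hua hub)
  have h1 : 1 * #R ≤ G.adjCount R {u, a, b} := by
    refine mul_le_adjCount fun x hx => ?_
    rcases hRadj x hx with h | h <;> exact one_le_adjCount_singleton (by simp) h
  have hcard : #R + 3 = Fintype.card V := by
    have h3 : #({u, a, b} : Finset V) = 3 :=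
      card_eq_three.2 ⟨u, a, b, hua.ne, hub.ne, hab.ne, rfl⟩
    rw [← card_univ, ← card_sdiff_add_card_eq_card (subset_univ {u, a, b}), h3]
  let H := G.induce (R : Set V)
  have hAB : ∀ x y : (R : Set V), G.Adj x a → G.Adj y b → H.Reachable x y := by
    rintro ⟨x, hx⟩ ⟨y, hy⟩ hxa hyb
    simp only at hxa hyb
    have hx' := hnot x hx hxa
    have hy' := fun h => hnot y hy h hyb
    by_cases hxy : G.Adj x y
    · exact Adj.reachable (G := H) (by simpa [H] using hxy)
    · obtain ⟨p, -, hp, hp', -⟩ := hS x y (by rintro rfl; exact hy' hxa) hxy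
      have hpR : p ∈ R := by
        rw [mem_coe, hmem] at hx
        rw [hmem]
        refine ⟨?_, ?_, ?_⟩
        · rintro rfl; have := (hu x).1 hp.symm; tauto
        · rintro rfl; exact hy' hp'
        · rintro rfl; exact hx' hp
      exact (Adj.reachable (G := H) (v := ⟨p, hpR⟩) (by simpa [H] using hp)).trans
        (Adj.reachable (G := H) (by simpa [H] using hp'.symm))
  obtain ⟨x0, hx0⟩ : ∃ x : (R : Set V), G.Adj x a := by
    obtain ⟨w, hw, hw'⟩ := hdom b
    have hwR : w ∈ R := by
      rw [hmem]
      refine ⟨?_, ?_, hw⟩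
      · rintro rfl; exact hw' hub.symm
      · rintro rfl; exact hw' hab.symm
    exact ⟨⟨w, hwR⟩, (hRadj w hwR).resolve_right fun h => hw' h.symm⟩
  obtain ⟨y0, hy0⟩ : ∃ x : (R : Set V), G.Adj x b := by
    obtain ⟨w, hw, hw'⟩ := hdom a
    have hwR : w ∈ R := by
      rw [hmem]
      refine ⟨?_, hw, ?_⟩
      · rintro rfl; exact hw' hua.symm
      · rintro rfl; exact hw' hab
    exact ⟨⟨w, hwR⟩, (hRadj w hwR).resolve_left fun h => hw' h.symm⟩
  have hconn : H.Connected := by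
    rw [connected_iff_exists_forall_reachable]
    refine ⟨x0, fun y => ?_⟩
    rcases hRadj y y.2 with h | h
    · exact (hAB x0 y0 hx0 hy0).trans (hAB y y0 h hy0).symm
    · exact hAB x0 y hx0 h
  have h2 := hconn.card_vert_le_card_edgeSet_add_one
  have h3 := adjCount_univ_induce (G := G) R
  rw [adjCount_univ] at h3
  rw [Nat.card_coe_set_eq, Set.ncard_coe_finset, Nat.card_coe_set_eq] at h2
  change 2 * H.edgeSet.ncard = _ at h3
  omega

/-- Vertices of `C` send two edges to `{a, b}`, those of `D` only one. The missing `#D` edges come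
from `key`: each `z` in `D` has a neighbour in `C` or two in `D`. The total is at least `2 + 2 * (n
- 3)`. -/
theorem le_card_edges_of_degree_two_of_not_adj
    (hS : ∀ u v, u ≠ v → ¬ G.Adj u v → G.DiamondLinked u v) {u a b : V} (hne : a ≠ b)
    (hu : ∀ w, G.Adj u w ↔ w = a ∨ w = b) (hab : ¬ G.Adj a b) :
    2 * Fintype.card V ≤ G.edgeSet.ncard + 4 := by
  classical
  have hua : G.Adj u a := (hu a).2 (.inl rfl)
  have hub : G.Adj u b := (hu b).2 (.inr rfl)
  have hn : u ∉ ({a, b} : Finset V) := by simp [hua.ne, hub.ne]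
  have h0 := two_mul_card_edges_eq (G := G) {u, a, b}
  have hK : G.adjCount {u, a, b} {u, a, b} = 4 := by
    have hba : ¬ G.Adj b a := fun h => hab h.symm
    simp [adjCount, sum_insert hn, sum_pair hne, hua, hub, hua.symm, hub.symm, hab, hba]
  set R : Finset V := univ \ {u, a, b} with hR
  have hmem : ∀ x, x ∈ R ↔ x ≠ u ∧ x ≠ a ∧ x ≠ b := by simp [hR]
  have hcard : #R + 3 = Fintype.card V := by
    have h3 : #({u, a, b} : Finset V) = 3 := card_eq_three.2 ⟨u, a, b, hua.ne, hub.ne, hne, rfl⟩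
    rw [← card_univ, ← card_sdiff_add_card_eq_card (subset_univ {u, a, b}), h3]
  set C : Finset V := {x ∈ R | G.Adj x a ∧ G.Adj x b} with hC
  set D : Finset V := {x ∈ R | ¬ (G.Adj x a ∧ G.Adj x b)} with hD
  have hCD : Disjoint C D := disjoint_filter_filter_not _ _ _
  have hCDR : C ∪ D = R := filter_union_filter_not_eq _ _
  have hcard' : #C + #D = #R := card_filter_add_card_filter_not _
  have hRadj : ∀ x ∈ R, G.Adj x a ∨ G.Adj x b := by
    intro x hx
    rw [hmem] at hx
    obtain ⟨p, -, hp, hp', -⟩ := hS u x hx.1.symm (by rw [hu]; tauto)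
    rcases (hu p).1 hp with rfl | rfl <;> simp [hp']
  have h1 : 2 * #C ≤ G.adjCount C {u, a, b} := by
    refine mul_le_adjCount fun x hx => ?_
    have hx := (mem_filter.1 hx).2
    exact two_le_adjCount_singleton (by simp) (by simp) hne hx.1 hx.2
  have h2 : 1 * #D ≤ G.adjCount D {u, a, b} := by
    refine mul_le_adjCount fun x hx => ?_
    rcases hRadj x (mem_filter.1 hx).1 with h | h <;> exact one_le_adjCount_singleton (by simp) h
  have key : ∀ z ∈ D, 2 ≤ G.adjCount {z} D + 2 * G.adjCount {z} C := by
    intro z hz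
    obtain ⟨hzR, hz⟩ := mem_filter.1 hz
    have hzm := (hmem z).1 hzR
    suffices ∃ p q, p ∈ R ∧ q ∈ R ∧ G.Adj z p ∧ G.Adj p a ∧ G.Adj z q ∧ G.Adj q b by
      obtain ⟨p, q, hp, hq, hzp, hpa, hzq, hqb⟩ := this
      by_cases hpC : p ∈ C
      · have := one_le_adjCount_singleton hpC hzp
        omega
      by_cases hqC : q ∈ C
      · have := one_le_adjCount_singleton hqC hzq
        omega
      have hpq : p ≠ q := by
        rintro rfl
        exact hpC (mem_filter.2 ⟨hp, hpa, hqb⟩)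
      rw [← hCDR, mem_union] at hp hq
      have := two_le_adjCount_singleton (hp.resolve_left hpC) (hq.resolve_left hqC) hpq hzp hzq
      omega
    -- The link of `b` and `z` supplies `q`. In the link of `u` and `z` the common neighbour must be
    -- `a`, and only a triangle on `z a` remains possible; its third vertex is `p`.
    have aux : ∀ a b, a ≠ b → (∀ w, G.Adj u w ↔ w = a ∨ w = b) → ¬ G.Adj a b →
        (∀ x, x ∈ R ↔ x ≠ u ∧ x ≠ a ∧ x ≠ b) → G.Adj z a → ¬ G.Adj z b →
        ∃ p q, p ∈ R ∧ q ∈ R ∧ G.Adj z p ∧ G.Adj p a ∧ G.Adj z q ∧ G.Adj q b := by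
      intro a b hne hu hab hmem hza hzb
      have hzm := (hmem z).1 hzR
      have huz : ¬ G.Adj u z := by rw [hu]; tauto
      obtain ⟨q, -, hbq, hzq, -⟩ := hS b z hzm.2.2.symm fun h => hzb h.symm
      obtain ⟨w, p, huw, hzw, hwp, h⟩ := hS u z hzm.1.symm huz
      obtain rfl : w = a := ((hu w).1 huw).resolve_right (by rintro rfl; exact hzb hzw)
      have hup : ∀ x, G.Adj u x → w ≠ x → x = b := fun x hx hwx =>
        ((hu x).1 hx).resolve_left hwx.symm
      have hp : G.Adj w p ∧ G.Adj z p := by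
        rcases h with h | h | h
        · exact absurd h.2 (hup p h.1 hwp ▸ hzb)
        · exact absurd h.1 (hup p h.2 hwp ▸ hab)
        · exact h
      refine ⟨p, q, (hmem p).2 ⟨?_, hwp.symm, ?_⟩, (hmem q).2 ⟨?_, ?_, hbq.ne'⟩, hp.2,
        hp.1.symm, hzq, hbq.symm⟩
      · rintro rfl; exact huz hp.2.symm
      · rintro rfl; exact hzb hp.2
      · rintro rfl; exact huz hzq.symm
      · rintro rfl; exact hab hbq.symm
    rcases hRadj z hzR with h | h
    · exact aux a b hne hu hab hmem h fun h' => hz ⟨h, h'⟩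
    · obtain ⟨p, q, h1, h2, h3, h4, h5, h6⟩ := aux b a hne.symm (fun w => by rw [hu, or_comm])
        (fun h => hab h.symm) (fun x => by rw [hmem]; tauto) h fun h' => hz ⟨h', h⟩
      exact ⟨q, p, h2, h1, h5, h6, h3, h4⟩
  have h3 : 2 * #D ≤ G.adjCount D D + 2 * G.adjCount D C := by
    rw [adjCount_eq_sum D D, adjCount_eq_sum D C, mul_sum, ← sum_add_distrib, mul_comm]
    simpa using card_nsmul_le_sum D _ 2 key
  rw [hK, ← hCDR, adjCount_disjUnion_left hCD, adjCount_disjUnion_self hCD] at h0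
  omega

/-- Each vertex of `R` has weight at least 4, counting neighbours in `K` twice. This is one edge
short of the bound, supplied by an edge among `a`, `b`, `c` or, by parity, by one vertex of weight
5. Failing both, a vertex of `R` would have at most two neighbours in `R`, yet needs three to reach
`a`, `b` and `c`. -/
theorem le_card_edges_of_degree_three
    (hS : ∀ u v, u ≠ v → ¬ G.Adj u v → G.DiamondLinked u v)
    (hδ : ∀ v, 3 ≤ G.adjCount {v} univ) {u a b c : V} (hab : a ≠ b) (hac : a ≠ c) (hbc : b ≠ c)
    (hu : ∀ w, G.Adj u w ↔ w = a ∨ w = b ∨ w = c) (hn : 5 ≤ Fintype.card V) :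
    2 * Fintype.card V ≤ G.edgeSet.ncard + 4 := by
  classical
  have hua : G.Adj u a := (hu a).2 (by simp)
  have hub : G.Adj u b := (hu b).2 (by simp)
  have huc : G.Adj u c := (hu c).2 (by simp)
  have hnu : u ∉ ({a, b, c} : Finset V) := by simp [hua.ne, hub.ne, huc.ne]
  have hna : a ∉ ({b, c} : Finset V) := by simp [hab, hac]
  set K : Finset V := {u, a, b, c} with hKdef
  have h0 := two_mul_card_edges_eq (G := G) K
  set R : Finset V := univ \ K with hR
  have hmem : ∀ x, x ∈ R ↔ x ≠ u ∧ x ≠ a ∧ x ≠ b ∧ x ≠ c := by simp [hR, hKdef]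
  have hcard : #R + 4 = Fintype.card V := by
    have h3 : #K = 4 := by
      rw [hKdef, card_insert_of_notMem hnu, card_insert_of_notMem hna, card_pair hbc]
    rw [← card_univ, ← card_sdiff_add_card_eq_card (subset_univ K), h3]
  have hRadj : ∀ x ∈ R, G.Adj x a ∨ G.Adj x b ∨ G.Adj x c := by
    intro x hx
    rw [hmem] at hx
    obtain ⟨p, -, hp, hp', -⟩ := hS u x hx.1.symm (by rw [hu]; tauto)
    rcases (hu p).1 hp with rfl | rfl | rfl <;> simp [hp']
  have hdeg : ∀ x, 3 ≤ G.adjCount {x} K + G.adjCount {x} R := fun x => by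
    rw [← adjCount_disjUnion_right disjoint_sdiff, union_sdiff_of_subset (subset_univ K)]
    exact hδ x
  have hRK : ∀ x ∈ R, 1 ≤ G.adjCount {x} K := fun x hx => by
    rcases hRadj x hx with h | h | h <;> exact one_le_adjCount_singleton (by simp [hKdef]) h
  have key : ∀ x ∈ R, 4 ≤ 2 * G.adjCount {x} K + G.adjCount {x} R := fun x hx => by
    have := hdeg x
    have := hRK x hx
    omega
  have hsum : 2 * G.adjCount R K + G.adjCount R R =
      ∑ x ∈ R, (2 * G.adjCount {x} K + G.adjCount {x} R) := by
    rw [adjCount_eq_sum R K, adjCount_eq_sum R R, mul_sum, ← sum_add_distrib]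
  have hsum4 : 4 * #R = ∑ x ∈ R, 4 := by simp [mul_comm]
  have h1 : 4 * #R ≤ 2 * G.adjCount R K + G.adjCount R R := by
    rw [hsum, hsum4]
    exact sum_le_sum key
  have hK : G.adjCount K K = 6 + G.adjCount {a, b, c} {a, b, c} := by
    have hd : Disjoint {u} ({a, b, c} : Finset V) := by simpa using hnu
    have hK' : K = {u} ∪ {a, b, c} := rfl
    rw [hK', adjCount_disjUnion_self hd]
    have e1 : G.adjCount {u} {u} = 0 := by simp [adjCount]
    have e2 : G.adjCount {a, b, c} {u} = 3 := by
      rw [adjCount_comm, adjCount_singleton, filter_true_of_mem (by simp [hua, hub, huc])]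
      exact card_eq_three.2 ⟨a, b, c, hab, hac, hbc, rfl⟩
    omega
  by_cases hind : G.adjCount {a, b, c} {a, b, c} = 0
  swap
  · obtain ⟨m, hm⟩ := even_adjCount_self (G := G) {a, b, c}
    omega
  have hind' : ∀ x ∈ ({a, b, c} : Finset V), ∀ y ∈ ({a, b, c} : Finset V), ¬ G.Adj x y := by
    intro x hx y hy hxy
    rw [adjCount_eq_sum, sum_eq_zero_iff] at hind
    have := one_le_adjCount_singleton hy hxy
    have := hind x hx
    omega
  by_cases hex : ∃ x ∈ R, 5 ≤ 2 * G.adjCount {x} K + G.adjCount {x} R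
  · have h2 : 4 * #R < 2 * G.adjCount R K + G.adjCount R R := by
      rw [hsum, hsum4]
      obtain ⟨x, hx, hx5⟩ := hex
      exact sum_lt_sum key ⟨x, hx, by omega⟩
    omega
  exfalso
  push Not at hex
  have hK1 : ∀ x ∈ R, G.adjCount {x} K = 1 := fun x hx => by
    have := hdeg x
    have := hRK x hx
    have := hex x hx
    omega
  have hR2 : ∀ x ∈ R, G.adjCount {x} R ≤ 2 := fun x hx => by
    have := hRK x hx
    have := hex x hx
    omega
  have huniq : ∀ x ∈ R, ∀ y ∈ K, ∀ z ∈ K, G.Adj x y → G.Adj x z → y = z := by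
    intro x hx y hy z hz hxy hxz
    by_contra hyz
    have := two_le_adjCount_singleton hy hz hyz hxy hxz
    have := hK1 x hx
    omega
  obtain ⟨x, hx⟩ : R.Nonempty := card_pos.1 (by omega)
  have hxm := (hmem x).1 hx
  obtain ⟨p, hpabc, hxp⟩ : ∃ p ∈ ({a, b, c} : Finset V), G.Adj x p := by
    rcases hRadj x hx with h | h | h
    · exact ⟨a, by simp, h⟩
    · exact ⟨b, by simp, h⟩
    · exact ⟨c, by simp, h⟩
  have hsub : ∀ y ∈ ({a, b, c} : Finset V), y ∈ K := fun y hy => mem_insert_of_mem hy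
  have hu' : ∀ w, G.Adj u w ↔ w ∈ ({a, b, c} : Finset V) := by simpa using hu
  have hux : ¬ G.Adj u x := by rw [hu]; tauto
  have hRiff : ∀ y, y ∈ R ↔ y ≠ u ∧ y ∉ ({a, b, c} : Finset V) := by simpa using hmem
  -- every vertex of `N(u)` has a common neighbour with `x` in `R`
  have hcommon : ∀ q ∈ ({a, b, c} : Finset V), ∃ y ∈ R, G.Adj x y ∧ G.Adj y q := by
    intro q hq
    by_cases hqp : q = p
    · subst hqp
      obtain ⟨w, y, huw, hxw, hwy, h⟩ := hS u x hxm.1.symm hux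
      obtain rfl : w = q := huniq x hx w (hsub w ((hu' w).1 huw)) q (hsub q hq) hxw hxp
      have hy : G.Adj w y ∧ G.Adj x y := by
        rcases h with h | h | h
        · exact absurd (huniq x hx y (hsub y ((hu' y).1 h.1)) w (hsub w hq) h.2 hxp) hwy.symm
        · exact absurd h.1 (hind' w hq y ((hu' y).1 h.2))
        · exact h
      refine ⟨y, (hRiff y).2 ⟨?_, fun hy' => hind' w hq y hy' hy.1⟩, hy.2, hy.1.symm⟩
      rintro rfl; exact hux hy.2.symm
    · have hxq : ¬ G.Adj x q := fun h => hqp (huniq x hx q (hsub q hq) p (hsub p hpabc) h hxp)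
      obtain ⟨y, -, hxy, hqy, -⟩ := hS x q (by rintro rfl; exact ((hRiff x).1 hx).2 hq) hxq
      refine ⟨y, (hRiff y).2 ⟨?_, fun hy' => hind' q hq y hy' hqy⟩, hxy, hqy.symm⟩
      rintro rfl; exact hux hxy.symm
  obtain ⟨y1, hy1, hxy1, hy1a⟩ := hcommon a (by simp)
  obtain ⟨y2, hy2, hxy2, hy2b⟩ := hcommon b (by simp)
  obtain ⟨y3, hy3, hxy3, hy3c⟩ := hcommon c (by simp)
  have haK : a ∈ K := by simp [hKdef]
  have hbK : b ∈ K := by simp [hKdef]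
  have hcK : c ∈ K := by simp [hKdef]
  have h12 : y1 ≠ y2 := by rintro rfl; exact hab (huniq _ hy1 _ haK _ hbK hy1a hy2b)
  have h13 : y1 ≠ y3 := by rintro rfl; exact hac (huniq _ hy1 _ haK _ hcK hy1a hy3c)
  have h23 : y2 ≠ y3 := by rintro rfl; exact hbc (huniq _ hy2 _ hbK _ hcK hy2b hy3c)
  have := three_le_adjCount_singleton hy1 hy2 hy3 h12 h13 h23 hxy1 hxy2 hxy3
  have := hR2 x hx
  omega

theorem le_card_edges_of_not_dominating (hF : G.DiamondFree)
    (hS : ∀ u v, u ≠ v → ¬ G.Adj u v → G.DiamondLinked u v)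
    (hdom : ∀ v, ∃ w, w ≠ v ∧ ¬ G.Adj v w) (hn : 5 ≤ Fintype.card V) :
    2 * Fintype.card V ≤ G.edgeSet.ncard + 4 := by
  classical
  have : Nontrivial V := Fintype.one_lt_card_iff_nontrivial.1 (by omega)
  have hnb : ∀ u s, ({b ∈ univ | G.Adj u b} : Finset V) = s → ∀ w, G.Adj u w ↔ w ∈ s := by
    rintro u s rfl w
    simp
  have h2 : ∀ v, 2 ≤ G.adjCount {v} univ := by
    intro u
    by_contra hlt
    rw [adjCount_singleton, not_le, Nat.lt_succ_iff, card_le_one_iff_subset_singleton] at hlt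
    obtain ⟨v, hv⟩ := hlt
    obtain ⟨w, hw, hw'⟩ := hdom v
    exact hw' (dominating_of_neighbors_subset_singleton hS
      (fun w hw => mem_singleton.1 (hv (by simpa using hw))) w hw)
  by_cases h3 : ∀ v, 3 ≤ G.adjCount {v} univ
  · by_cases h4 : ∀ v, 4 ≤ G.adjCount {v} univ
    · have := mul_le_adjCount (A := univ) fun v _ => h4 v
      rw [adjCount_univ, card_univ] at this
      omega
    · push Not at h4
      obtain ⟨u, hu⟩ := h4
      have hu : G.adjCount {u} univ = 3 := by have := h3 u; omega
      rw [adjCount_singleton, card_eq_three] at hu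
      obtain ⟨a, b, c, hab, hac, hbc, hu⟩ := hu
      exact le_card_edges_of_degree_three hS h3 hab hac hbc (by simpa using hnb u _ hu) hn
  · push Not at h3
    obtain ⟨u, hu⟩ := h3
    have hu : G.adjCount {u} univ = 2 := by have := h2 u; omega
    rw [adjCount_singleton, card_eq_two] at hu
    obtain ⟨a, b, hab, hu⟩ := hu
    have hu' : ∀ w, G.Adj u w ↔ w = a ∨ w = b := by simpa using hnb u _ hu
    by_cases h : G.Adj a b
    · exact le_card_edges_of_degree_two_of_adj hF hS hdom hu' h
    · exact le_card_edges_of_degree_two_of_not_adj hS hab hu' h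

end Fintype


/-! ### Blow-up patterns. -/

variable {W : Type*} {G' : SimpleGraph W}

theorem DiamondLinked.map (e : G ≃g G') {u v : V} (h : G.DiamondLinked u v) :
    G'.DiamondLinked (e u) (e v) := by
  obtain ⟨w, x, h⟩ := h
  exact ⟨e w, e x, by simpa [e.map_adj_iff] using h⟩

theorem Iso.isSaturated_k4Minus (e : G ≃g G') (h : IsSaturated K4Minus G) :
    IsSaturated K4Minus G' := by
  rw [isSaturated_k4Minus_iff] at h ⊢
  refine ⟨fun a b c d h1 h2 h3 h4 h5 => e.symm.injective (h.1 (e.symm.map_adj_iff.2 h1)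
    (e.symm.map_adj_iff.2 h2) (e.symm.map_adj_iff.2 h3) (e.symm.map_adj_iff.2 h4)
    (e.symm.map_adj_iff.2 h5)), fun u v huv hn => ?_⟩
  have := (h.2 (e.symm u) (e.symm v) (e.symm.injective.ne huv)
    fun h => hn (e.symm.map_adj_iff.1 h)).map e
  simpa using this

/-- A recipe for blowing up a graph on `T` vertex types into independent classes: `link i j` is `2`
if the classes `i` and `j` are completely joined, `1` if they are joined by a perfect matching, and
anything else if there are no edges between them. -/
structure BlowupPattern (T : ℕ) where
  /-- How two classes are joined. -/
  link : Fin T → Fin T → ℕ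
  symm : ∀ i j, link i j = link j i
  diag : ∀ i, link i i = 0

namespace BlowupPattern

variable {T : ℕ} (P : BlowupPattern T) (size : Fin T → ℕ)

/-- The graph in which the class of type `t` has `size t` vertices. -/
def graph : SimpleGraph (Σ t, Fin (size t)) where
  Adj x y := P.link x.1 y.1 = 2 ∨ P.link x.1 y.1 = 1 ∧ x.2.val = y.2.val
  symm := ⟨fun x y h => by rwa [P.symm y.1, eq_comm (a := y.2.val)]⟩
  loopless := ⟨fun x h => by simp [P.diag] at h⟩

/-- Twice the number of edges of `P.graph size`. -/
def dartCount : ℕ :=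
  ∑ t, ∑ s, if P.link t s = 2 then size t * size s else if P.link t s = 1 then size t else 0

/-- A condition on types that makes the graph diamond-free if the types below `c` have one vertex
each. -/
def IsDiamondFree (c : ℕ) : Prop :=
  ∀ t s, P.link t s = 1 ∨ P.link t s = 2 → ∀ p, P.link p t = 1 ∨ P.link p t = 2 →
    P.link p s = 1 ∨ P.link p s = 2 → (p.val < c ∨ P.link p t = 1 ∨ P.link p s = 1) ∧
      ∀ q, P.link q t = 1 ∨ P.link q t = 2 → P.link q s = 1 ∨ P.link q s = 2 → p = q

/-- A condition on types that makes non-adjacent vertices diamond-linked if the types below `c` have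
one vertex each. -/
def IsDiamondLinked (c : ℕ) : Prop :=
  ∀ t s, P.link t s ≠ 2 → (t = s → c ≤ t.val) →
    (∃ w, w.val < c ∧ P.link t w = 2 ∧ P.link s w = 2 ∧ ∃ x, w ≠ x ∧
      (x.val < c ∧ (P.link t x = 2 ∧ P.link s x = 2 ∨ P.link w x = 2 ∧ P.link t x = 2 ∨
        P.link w x = 2 ∧ P.link s x = 2) ∨
      P.link w x = 2 ∧ (P.link t x = 1 ∨ P.link s x = 1))) ∨
    (∃ w, P.link t w = 1 ∧ P.link s w = 2 ∧ ∃ x, x.val < c ∧ P.link w x = 2 ∧ P.link t x = 2) ∨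
    (∃ w, P.link s w = 1 ∧ P.link t w = 2 ∧ ∃ x, x.val < c ∧ P.link w x = 2 ∧ P.link s x = 2)

instance (c : ℕ) : Decidable (P.IsDiamondFree c) := by unfold IsDiamondFree; infer_instance

instance (c : ℕ) : Decidable (P.IsDiamondLinked c) := by unfold IsDiamondLinked; infer_instance

variable {P size}

theorem diamondFree_graph {c : ℕ} (hc : ∀ t : Fin T, t.val < c → size t = 1)
    (h : P.IsDiamondFree c) : (P.graph size).DiamondFree := by
  rintro ⟨p, i⟩ ⟨q, j⟩ ⟨t, k⟩ ⟨s, l⟩ h1 h2 h3 h4 h5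
  simp only [graph] at h1 h2 h3 h4 h5
  have imp : ∀ {a b : Fin T} {r : Prop}, P.link a b = 2 ∨ P.link a b = 1 ∧ r →
    P.link a b = 1 ∨ P.link a b = 2 := by tauto
  obtain ⟨h6, h7⟩ := h t s (imp h1) p (imp h2) (imp h3)
  obtain rfl := h7 q (imp h4) (imp h5)
  congr 1
  rcases h6 with h6 | h6 | h6
  · have := hc p h6
    ext; omega
  all_goals
    ext; omega

/-- Classes from `c` on may be empty, so witnesses are taken only from singleton classes or as
matching partners of `u` or `v`. -/
theorem diamondLinked_graph {c : ℕ} (hc : ∀ t : Fin T, t.val < c → size t = 1)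
    (hm : ∀ t s, P.link t s = 1 → size t = size s) (h : P.IsDiamondLinked c)
    (u v : Σ t, Fin (size t)) (huv : u ≠ v) (hn : ¬ (P.graph size).Adj u v) :
    (P.graph size).DiamondLinked u v := by
  obtain ⟨t, i⟩ := u
  obtain ⟨s, j⟩ := v
  have h1 : P.link t s ≠ 2 := fun h => hn (.inl h)
  have h2 : t = s → c ≤ t.val := by
    rintro rfl
    by_contra hlt
    have := hc t (by omega)
    exact huv (by congr 1; ext; omega)
  have aux : ∀ t s (i : Fin (size t)) (j : Fin (size s)),
      (∃ w, P.link t w = 1 ∧ P.link s w = 2 ∧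
        ∃ x, x.val < c ∧ P.link w x = 2 ∧ P.link t x = 2) →
      (P.graph size).DiamondLinked ⟨t, i⟩ ⟨s, j⟩ := by
    rintro t s i j ⟨w, h3, h4, x, h5, h6, h7⟩
    refine ⟨⟨w, Fin.cast (hm _ _ h3) i⟩, ⟨x, 0, by simp [hc x h5]⟩, .inr ⟨h3, rfl⟩, .inl h4, ?_,
      .inr (.inl ⟨.inl h6, .inl h7⟩)⟩
    intro e
    obtain rfl : w = x := congrArg Sigma.fst e
    simp [P.diag] at h6
  rcases h t s h1 h2 with ⟨w, hw, h3, h4, x, hwx, h5⟩ | h3 | h3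
  · refine ⟨⟨w, 0, by simp [hc w hw]⟩, ?_⟩
    have hne : ∀ k l, (⟨w, k⟩ : Σ t, Fin (size t)) ≠ ⟨x, l⟩ := fun k l e =>
      hwx (congrArg Sigma.fst e)
    rcases h5 with ⟨hx, h5⟩ | ⟨h5, h6 | h6⟩
    · refine ⟨⟨x, 0, by simp [hc x hx]⟩, .inl h3, .inl h4, hne _ _, ?_⟩
      simp only [graph]
      tauto
    · exact ⟨⟨x, Fin.cast (hm _ _ h6) i⟩, .inl h3, .inl h4, hne _ _,
        .inr (.inl ⟨.inl h5, .inr ⟨h6, rfl⟩⟩)⟩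
    · exact ⟨⟨x, Fin.cast (hm _ _ h6) j⟩, .inl h3, .inl h4, hne _ _,
        .inr (.inr ⟨.inl h5, .inr ⟨h6, rfl⟩⟩)⟩
  · exact aux t s i j h3
  · exact (aux s t j i h3).symm

theorem two_mul_card_edges_graph (hm : ∀ t s, P.link t s = 1 → size t = size s) :
    2 * (P.graph size).edgeSet.ncard = P.dartCount size := by
  classical
  rw [← adjCount_univ, adjCount, dartCount, ← univ_sigma_univ, sum_sigma]
  refine sum_congr rfl fun t _ => ?_
  simp only [sum_sigma]
  rw [sum_comm]
  refine sum_congr rfl fun s _ => ?_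
  simp only [graph]
  split_ifs with h1 h2
  · simp [h1]
  · have hst := hm t s h2
    have : ∀ i : Fin (size t), ∑ j : Fin (size s), (if i.val = j.val then 1 else 0) = 1 := by
      intro i
      rw [sum_eq_single (Fin.cast hst i)]
      · simp
      · intro j _ hj
        rw [if_neg]
        contrapose! hj
        ext
        simp [hj]
      · simp
    simp [h2, this]
  · simp [h1, h2]

theorem exists_isSaturated {c : ℕ} (hc : ∀ t : Fin T, t.val < c → size t = 1)
    (hm : ∀ t s, P.link t s = 1 → size t = size s) (hF : P.IsDiamondFree c)
    (hL : P.IsDiamondLinked c) {n m : ℕ} (hn : ∑ t, size t = n) (hd : P.dartCount size = 2 * m) :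
    ∃ G : SimpleGraph (Fin n), IsSaturated K4Minus G ∧ G.edgeSet.ncard = m ∧
      Nonempty (P.graph size ≃g G) := by
  have hcard : Fintype.card (Σ t, Fin (size t)) = n := by simp [hn]
  let e := (P.graph size).overFinIso hcard
  refine ⟨_, e.isSaturated_k4Minus (isSaturated_k4Minus_iff.2
    ⟨diamondFree_graph hc hF, diamondLinked_graph hc hm hL⟩), ?_, ⟨e⟩⟩
  have := two_mul_card_edges_graph hm
  have h2 := Nat.card_congr e.mapEdgeSet
  rw [Nat.card_coe_set_eq, Nat.card_coe_set_eq] at h2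
  omega

end BlowupPattern

end SimpleGraph

/-! ### The constructions. -/

namespace SimpleGraph.BlowupPattern

/-- A triangle `0, 1, 2` joined to a complete bipartite graph, one vertex of which has lost its edges
to the class `7`. -/
def triangleBipartite : BlowupPattern 10 where
  link := ![
    ![0, 2, 2, 2, 2, 0, 0, 2, 0, 0],
    ![2, 0, 2, 0, 0, 2, 2, 0, 0, 2],
    ![2, 2, 0, 0, 0, 0, 0, 0, 2, 0],
    ![2, 0, 0, 0, 2, 0, 0, 0, 2, 0],
    ![2, 0, 0, 2, 0, 2, 2, 0, 0, 2],
    ![0, 2, 0, 0, 2, 0, 0, 2, 2, 0],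
    ![0, 2, 0, 0, 2, 0, 0, 2, 2, 0],
    ![2, 0, 0, 0, 0, 2, 2, 0, 0, 2],
    ![0, 0, 2, 2, 0, 2, 2, 0, 0, 2],
    ![0, 2, 0, 0, 2, 0, 0, 2, 2, 0]]
  symm := by decide
  diag := by decide

/-- Every vertex off the triangle has exactly one neighbour on it, giving `n` edges in all with the
triangle's own; the rest form a complete bipartite graph with parts `1 + j + k` and `3 + l`, less
`j` edges. -/
theorem exists_triangleBipartite {j k l m : ℕ}
    (hm : m + j = (7 + j + k + l) + (1 + j + k) * (3 + l)) :
    ∃ G : SimpleGraph (Fin (7 + j + k + l)),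
      IsSaturated K4Minus G ∧ ¬ G.IsBipartite ∧ G.edgeSet.ncard = m := by
  obtain ⟨G, h1, h2, ⟨e⟩⟩ := exists_isSaturated (P := triangleBipartite)
    (size := ![1, 1, 1, 1, 1, 1, 1, j, k, l]) (c := 7) (n := 7 + j + k + l) (m := m)
    (by simp [Fin.forall_fin_succ]) (by simp [Fin.forall_fin_succ, triangleBipartite])
    (by decide) (by decide) (by simp [Fin.sum_univ_succ]; ring)
    (by simp [dartCount, triangleBipartite, Fin.sum_univ_succ]; linarith)
  refine ⟨G, h1, ?_, h2⟩
  rintro ⟨C⟩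
  have h (x y) (hxy : (triangleBipartite.graph ![1, 1, 1, 1, 1, 1, 1, j, k, l]).Adj x y) :
      C (e x) ≠ C (e y) := C.valid (e.map_adj_iff.2 hxy)
  have h01 := h ⟨0, (0 : Fin 1)⟩ ⟨1, (0 : Fin 1)⟩ (.inl rfl)
  have h02 := h ⟨0, (0 : Fin 1)⟩ ⟨2, (0 : Fin 1)⟩ (.inl rfl)
  have h12 := h ⟨1, (0 : Fin 1)⟩ ⟨2, (0 : Fin 1)⟩ (.inl rfl)
  omega

/-- A triangle `0, 1, 2` with a further triangle `1, 3, 4` and several triangles at `2`, the classes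
`5` and `6` of which are matched. -/
def twoHubs : BlowupPattern 8 where
  link := ![
    ![0, 2, 2, 0, 0, 0, 0, 0],
    ![2, 0, 2, 2, 2, 0, 0, 0],
    ![2, 2, 0, 0, 0, 2, 2, 2],
    ![0, 2, 0, 0, 2, 2, 0, 2],
    ![0, 2, 0, 2, 0, 0, 2, 0],
    ![0, 0, 2, 2, 0, 0, 1, 0],
    ![0, 0, 2, 0, 2, 1, 0, 0],
    ![0, 0, 2, 2, 0, 0, 0, 0]]
  symm := by decide
  diag := by decide

/-- With `n` vertices, the number of edges is `2 * n - 4 + k`. -/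
theorem exists_twoHubs (k l : ℕ) : ∃ G : SimpleGraph (Fin (5 + 2 * k + l)),
    IsSaturated K4Minus G ∧ G.edgeSet.ncard = 6 + 5 * k + 2 * l := by
  obtain ⟨G, h1, h2, -⟩ := exists_isSaturated (P := twoHubs)
    (size := ![1, 1, 1, 1, 1, k, k, l]) (c := 5) (n := 5 + 2 * k + l) (m := 6 + 5 * k + 2 * l)
    (by simp [Fin.forall_fin_succ]) (by simp [Fin.forall_fin_succ, twoHubs])
    (by decide) (by decide) (by simp [Fin.sum_univ_succ]; ring)
    (by simp [dartCount, twoHubs, Fin.sum_univ_succ]; ring)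
  exact ⟨G, h1, h2⟩

/-- A complete bipartite graph with one part `0, 1, 2` and with triangles glued along edges at `0`. -/
def gluedTriangles : BlowupPattern 10 where
  link := ![
    ![0, 0, 0, 2, 2, 2, 2, 2, 2, 2],
    ![0, 0, 0, 2, 0, 2, 0, 2, 0, 2],
    ![0, 0, 0, 2, 0, 2, 0, 2, 0, 2],
    ![2, 2, 2, 0, 2, 0, 0, 0, 0, 0],
    ![2, 0, 0, 2, 0, 0, 0, 0, 0, 0],
    ![2, 2, 2, 0, 0, 0, 2, 0, 0, 0],
    ![2, 0, 0, 0, 0, 2, 0, 0, 0, 0],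
    ![2, 2, 2, 0, 0, 0, 0, 0, 1, 0],
    ![2, 0, 0, 0, 0, 0, 0, 1, 0, 0],
    ![2, 2, 2, 0, 0, 0, 0, 0, 0, 0]]
  symm := by decide
  diag := by decide

/-- With `n` vertices, the number of edges is `3 * n - 11 - k`. -/
theorem exists_gluedTriangles (k l : ℕ) : ∃ G : SimpleGraph (Fin (7 + 2 * k + l)),
    IsSaturated K4Minus G ∧ G.edgeSet.ncard = 10 + 5 * k + 3 * l := by
  obtain ⟨G, h1, h2, -⟩ := exists_isSaturated (P := gluedTriangles)
    (size := ![1, 1, 1, 1, 1, 1, 1, k, k, l]) (c := 7) (n := 7 + 2 * k + l) (m := 10 + 5 * k + 3 * l)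
    (by simp [Fin.forall_fin_succ]) (by simp [Fin.forall_fin_succ, gluedTriangles])
    (by decide) (by decide) (by simp [Fin.sum_univ_succ]; ring)
    (by simp [dartCount, gluedTriangles, Fin.sum_univ_succ]; ring)
  exact ⟨G, h1, h2⟩

/-- Triangles sharing a vertex. -/
def friendship : BlowupPattern 3 where
  link := ![
    ![0, 2, 2],
    ![2, 0, 1],
    ![2, 1, 0]]
  symm := by decide
  diag := by decide

theorem exists_friendship (k : ℕ) : ∃ G : SimpleGraph (Fin (1 + 2 * k)),
    IsSaturated K4Minus G ∧ G.edgeSet.ncard = 3 * k := by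
  obtain ⟨G, h1, h2, -⟩ := exists_isSaturated (P := friendship)
    (size := ![1, k, k]) (c := 1) (n := 1 + 2 * k) (m := 3 * k)
    (by simp) (by simp [Fin.forall_fin_succ, friendship])
    (by decide) (by decide) (by simp [Fin.sum_univ_succ]; ring)
    (by simp [dartCount, friendship, Fin.sum_univ_succ]; ring)
  exact ⟨G, h1, h2⟩

/-- Triangles sharing a vertex, which has one further neighbour. -/
def friendshipPendant : BlowupPattern 4 where
  link := ![
    ![0, 2, 2, 2],
    ![2, 0, 0, 0],
    ![2, 0, 0, 1],
    ![2, 0, 1, 0]]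
  symm := by decide
  diag := by decide

theorem exists_friendshipPendant (k : ℕ) : ∃ G : SimpleGraph (Fin (2 + 2 * k)),
    IsSaturated K4Minus G ∧ G.edgeSet.ncard = 1 + 3 * k := by
  obtain ⟨G, h1, h2, -⟩ := exists_isSaturated (P := friendshipPendant)
    (size := ![1, 1, k, k]) (c := 2) (n := 2 + 2 * k) (m := 1 + 3 * k)
    (by simp [Fin.forall_fin_succ]) (by simp [Fin.forall_fin_succ, friendshipPendant])
    (by decide) (by decide) (by simp [Fin.sum_univ_succ]; ring)
    (by simp [dartCount, friendshipPendant, Fin.sum_univ_succ]; ring)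
  exact ⟨G, h1, h2⟩

/-- A complete bipartite graph with parts `0, 1, 4` and `2, 3, 5`. -/
def bipartite : BlowupPattern 6 where
  link := ![
    ![0, 0, 2, 2, 0, 2],
    ![0, 0, 2, 2, 0, 2],
    ![2, 2, 0, 0, 2, 0],
    ![2, 2, 0, 0, 2, 0],
    ![0, 0, 2, 2, 0, 2],
    ![2, 2, 0, 0, 2, 0]]
  symm := by decide
  diag := by decide

theorem exists_bipartite (k l : ℕ) : ∃ G : SimpleGraph (Fin (4 + k + l)),
    IsSaturated K4Minus G ∧ G.edgeSet.ncard = (2 + k) * (2 + l) := by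
  obtain ⟨G, h1, h2, -⟩ := exists_isSaturated (P := bipartite)
    (size := ![1, 1, 1, 1, k, l]) (c := 4) (n := 4 + k + l) (m := (2 + k) * (2 + l))
    (by simp [Fin.forall_fin_succ]) (by simp [Fin.forall_fin_succ, bipartite])
    (by decide) (by decide) (by simp [Fin.sum_univ_succ]; ring)
    (by simp [dartCount, bipartite, Fin.sum_univ_succ]; ring)
  exact ⟨G, h1, h2⟩

end SimpleGraph.BlowupPattern

/-! ### Assembling the spectrum. -/

namespace SimpleGraph

section

variable {V : Type*} [Fintype V] {G : SimpleGraph V}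

theorem card_edges_of_isBipartite (hn : 3 ≤ Fintype.card V) (hG : IsSaturated K4Minus G)
    (hb : G.IsBipartite) : ∃ i, 2 ≤ i ∧ i ≤ Fintype.card V - 2 ∧
      G.edgeSet.ncard = i * (Fintype.card V - i) := by
  classical
  obtain ⟨-, hS⟩ := isSaturated_k4Minus_iff.1 hG
  obtain ⟨f⟩ := hb
  have hf : ∀ {x y}, G.Adj x y → f x ≠ f y := fun h => f.valid h
  have hcomp : ∀ x y, f x ≠ f y → G.Adj x y := by
    intro x y hxy
    by_contra hn
    obtain ⟨w, -, hxw, hyw, -⟩ := hS x y (fun e => hxy (e ▸ rfl)) hn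
    have := hf hxw
    have := hf hyw
    omega
  -- Two vertices of one colour are linked, and without triangles this means two common neighbours,
  -- both of the other colour.
  have htwo : ∀ i j : Fin 2, i ≠ j → 2 ≤ #{x | f x = j} → 2 ≤ #{x | f x = i} := by
    intro i j hij h2
    obtain ⟨x, hx, y, hy, hxy⟩ := one_lt_card.1 h2
    simp only [mem_filter, mem_univ, true_and] at hx hy
    obtain ⟨p, q, hxp, hyp, hpq, h⟩ := hS x y hxy fun h => hf h (hx.trans hy.symm)
    have h1 := hf hxp
    have h2 := hf hyp
    have hq : f q = i := by
      rcases h with h | h | h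
      · have := hf h.1
        omega
      all_goals
        have := hf h.1
        have := hf h.2
        omega
    exact one_lt_card.2 ⟨p, by simp; omega, q, by simp [hq], hpq⟩
  set A : Finset V := {x | f x = 0} with hA
  have hB : univ \ A = ({x | f x = 1} : Finset V) := by
    ext x
    simp only [hA, mem_sdiff, mem_univ, true_and, mem_filter]
    omega
  have hcard := card_sdiff_add_card_eq_card (subset_univ A)
  have h0 := two_mul_card_edges_eq (G := G) A
  rw [card_univ] at hcard
  rw [hB] at hcard h0
  set B : Finset V := {x | f x = 1} with hBdef
  have h1 := htwo 0 1 (by simp)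
  have h2 := htwo 1 0 (by simp)
  rw [← hA, ← hBdef] at h1 h2
  have hAA : G.adjCount A A = 0 := adjCount_self_eq_zero fun a ha b hb hab =>
    hf hab (by simp_all)
  have hBB : G.adjCount B B = 0 := adjCount_self_eq_zero fun a ha b hb hab =>
    hf hab (by simp_all)
  have hBA : G.adjCount B A = #A * #B := by
    have : ∀ b ∈ B, G.adjCount {b} A = #A := fun b hb => by
      rw [adjCount_singleton, filter_true_of_mem fun a ha => hcomp b a (by simp_all)]
    rw [adjCount_eq_sum, sum_congr rfl this, sum_const, smul_eq_mul, mul_comm]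
  refine ⟨#A, by omega, by omega, ?_⟩
  have hB' : Fintype.card V - #A = #B := by omega
  rw [hB', ← hBA]
  omega

theorem card_edges_of_isSaturated (hn : 5 ≤ Fintype.card V) (hG : IsSaturated K4Minus G) :
    G.edgeSet.ncard = 3 * (Fintype.card V - 1) / 2 ∨
      2 * Fintype.card V - 4 ≤ G.edgeSet.ncard := by
  obtain ⟨hF, hS⟩ := isSaturated_k4Minus_iff.1 hG
  by_cases h : ∃ v, ∀ w, w ≠ v → G.Adj v w
  · obtain ⟨v, hv⟩ := h
    exact .inl (card_edges_eq_of_dominating hF hS hv)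
  · push Not at h
    have := le_card_edges_of_not_dominating hF hS h hn
    omega

end

/-- Take the least `t ≥ 3` with `e ≤ (r - t) * t`. For `t > 3` minimality bounds the deficit `j`;
for `t = 3` the bound `2 * r ≤ e + 5` does, which is the source of `3 * n - 11`. -/
theorem exists_mul_sub_sub {r e : ℕ} (hr : 6 ≤ r) (h1 : 2 * r ≤ e + 5) (h2 : e ≤ r ^ 2 / 4) :
    ∃ s t j, s + t = r ∧ 3 ≤ t ∧ j + 1 ≤ s ∧ e + j = s * t := by
  classical
  have hhalf : 3 ≤ r / 2 ∧ e ≤ (r - r / 2) * (r / 2) := by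
    refine ⟨by omega, h2.trans ?_⟩
    obtain ⟨m, rfl | rfl⟩ := Nat.even_or_odd' r
    · have h3 : 2 * m / 2 = m := by omega
      have h4 : 2 * m - m = m := by omega
      have h5 : (2 * m) ^ 2 = 4 * (m * m) := by ring
      rw [h3, h4]
      omega
    · have h3 : (2 * m + 1) / 2 = m := by omega
      have h4 : 2 * m + 1 - m = m + 1 := by omega
      have h5 : (2 * m + 1) ^ 2 = 4 * ((m + 1) * m) + 1 := by ring
      rw [h3, h4]
      omega
  obtain ⟨t, htr, ⟨h3, h4⟩, hmin⟩ : ∃ t, t ≤ r / 2 ∧ (3 ≤ t ∧ e ≤ (r - t) * t) ∧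
      ∀ k, k < t → ¬ (3 ≤ k ∧ e ≤ (r - k) * k) :=
    have hex : ∃ t, 3 ≤ t ∧ e ≤ (r - t) * t := ⟨_, hhalf⟩
    ⟨Nat.find hex, Nat.find_min' hex hhalf, Nat.find_spec hex, fun _ => Nat.find_min hex⟩
  obtain ⟨s, rfl⟩ : ∃ s, r = t + s := ⟨r - t, by omega⟩
  rw [Nat.add_sub_cancel_left] at h4
  refine ⟨s, t, s * t - e, by omega, h3, ?_, by omega⟩
  obtain rfl | ⟨k, rfl⟩ : t = 3 ∨ ∃ k, t = k + 4 := by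
    rcases h3.eq_or_lt with h | h
    · exact .inl h.symm
    · exact .inr ⟨t - 4, by omega⟩
  · omega
  · have h6 := hmin (k + 3) (by omega)
    have h5 : k + 4 + s - (k + 3) = s + 1 := by omega
    rw [h5, not_and, not_le] at h6
    have h6 := h6 (by omega)
    have h7 : (s + 1) * (k + 3) = s * k + k + 3 * s + 3 := by ring
    have h8 : s * (k + 4) = s * k + 4 * s := by ring
    omega

theorem exists_isSaturated_not_isBipartite {n m : ℕ} (hn : 10 ≤ n) (h1 : 3 * n - 11 ≤ m)
    (h2 : m ≤ ((n - 1) / 2) * ((n - 1) ⌈/⌉ 2) + 2) :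
    ∃ G : SimpleGraph (Fin n), IsSaturated K4Minus G ∧ ¬ G.IsBipartite ∧ G.edgeSet.ncard = m := by
  rw [half_mul_ceilHalf] at h2
  obtain ⟨r, rfl⟩ : ∃ r, n = r + 3 := ⟨n - 3, by omega⟩
  have h3 : (r + 3 - 1) ^ 2 = r ^ 2 + 4 * r + 4 := by
    rw [Nat.add_sub_assoc (by simp)]; ring
  rw [h3] at h2
  obtain ⟨s, t, j, hst, ht, hj, he⟩ := exists_mul_sub_sub (r := r) (e := m - (r + 3)) (by omega)
    (by omega) (by omega)
  obtain ⟨l, rfl⟩ : ∃ l, t = 3 + l := ⟨t - 3, by omega⟩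
  obtain ⟨k, rfl⟩ : ∃ k, s = 1 + j + k := ⟨s - (1 + j), by omega⟩
  have hr : r + 3 = 7 + j + k + l := by omega
  rw [hr]
  exact BlowupPattern.exists_triangleBipartite (by omega)

theorem exists_isSaturated_of_lt {n m : ℕ} (hn : 10 ≤ n) (h1 : 2 * n - 4 ≤ m)
    (h2 : m < 3 * n - 11) :
    ∃ G : SimpleGraph (Fin n), IsSaturated K4Minus G ∧ G.edgeSet.ncard = m := by
  -- `twoHubs` covers sizes up to about `5 * n / 2`, `gluedTriangles` those above.
  by_cases h : 2 * (m + 4 - 2 * n) + 5 ≤ n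
  · obtain ⟨k, hk⟩ : ∃ k, m + 4 = 2 * n + k := ⟨m + 4 - 2 * n, by omega⟩
    obtain ⟨l, rfl⟩ : ∃ l, n = 5 + 2 * k + l := ⟨n - (5 + 2 * k), by omega⟩
    obtain rfl : m = 6 + 5 * k + 2 * l := by omega
    exact BlowupPattern.exists_twoHubs k l
  · obtain ⟨k, hk⟩ : ∃ k, m + k + 11 = 3 * n := ⟨3 * n - 11 - m, by omega⟩
    obtain ⟨l, rfl⟩ : ∃ l, n = 7 + 2 * k + l := ⟨n - (7 + 2 * k), by omega⟩
    obtain rfl : m = 10 + 5 * k + 3 * l := by omega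
    exact BlowupPattern.exists_gluedTriangles k l

theorem exists_isSaturated_min {n : ℕ} (hn : 1 ≤ n) : ∃ G : SimpleGraph (Fin n),
    IsSaturated K4Minus G ∧ G.edgeSet.ncard = 3 * (n - 1) / 2 := by
  obtain ⟨k, rfl | rfl⟩ : ∃ k, n = 1 + 2 * k ∨ n = 2 + 2 * k := ⟨(n - 1) / 2, by omega⟩
  · have : 3 * (1 + 2 * k - 1) / 2 = 3 * k := by omega
    exact this ▸ BlowupPattern.exists_friendship k
  · have : 3 * (2 + 2 * k - 1) / 2 = 1 + 3 * k := by omega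
    exact this ▸ BlowupPattern.exists_friendshipPendant k

theorem exists_isSaturated_bipartite {n i : ℕ} (h2 : 2 ≤ i) (hi : i + 2 ≤ n) :
    ∃ G : SimpleGraph (Fin n), IsSaturated K4Minus G ∧ G.edgeSet.ncard = i * (n - i) := by
  obtain ⟨k, rfl⟩ : ∃ k, i = 2 + k := ⟨i - 2, by omega⟩
  obtain ⟨l, rfl⟩ : ∃ l, n = 4 + k + l := ⟨n - (4 + k), by omega⟩
  have : 4 + k + l - (2 + k) = 2 + l := by omega
  exact this ▸ BlowupPattern.exists_bipartite k l

theorem edgeSpectrum_k4Minus {n : ℕ} (hn : 10 ≤ n) :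
    edgeSpectrum n K4Minus =
      {3 * (n - 1) / 2} ∪
      Set.Icc (2 * n - 4) (((n - 1) / 2) * ((n - 1) ⌈/⌉ 2) + 2) ∪
      {m | ∃ i ∈ Set.Icc 2 (n - 2), m = i * (n - i)} := by
  ext m
  simp only [edgeSpectrum, Set.mem_union, Set.mem_singleton_iff, Set.mem_Icc, Set.mem_ofPred_eq]
  constructor
  · rintro ⟨G, hG, rfl⟩
    by_cases hb : G.IsBipartite
    · obtain ⟨i, h1, h2, h3⟩ := card_edges_of_isBipartite (by simp; omega) hG hb
      rw [Fintype.card_fin] at h2 h3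
      exact .inr ⟨i, ⟨h1, h2⟩, h3⟩
    · left
      have h1 := card_edges_of_isSaturated (by simp; omega) hG
      have h2 := mt (isBipartite_of_isSaturated_of_lt hG (by simp; omega)) hb
      rw [Fintype.card_fin] at h1 h2
      exact h1.imp_right fun h => ⟨h, not_lt.1 h2⟩
  · rintro ((rfl | ⟨h1, h2⟩) | ⟨i, ⟨h1, h2⟩, rfl⟩)
    · exact exists_isSaturated_min (by omega)
    · rcases lt_or_ge m (3 * n - 11) with h | h
      · exact exists_isSaturated_of_lt hn h1 h
      · obtain ⟨G, hG, -, hm⟩ := exists_isSaturated_not_isBipartite hn h h2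
        exact ⟨G, hG, hm⟩
    · exact exists_isSaturated_bipartite h1 (by omega)

end SimpleGraph

end

theorem theorem1 :
    -- (a)
    (∀ (V : Type*) [Fintype V] (G : SimpleGraph V) (n : ℕ), Fintype.card V = n → n ≠ 6 →
      IsSaturated K4Minus G →
      ((n - 1) / 2) * ((n - 1) ⌈/⌉ 2) + 2 < G.edgeSet.ncard →
      G.IsBipartite) ∧
    -- (b)
    (∀ n : ℕ, 10 ≤ n → ∀ m : ℕ, 3 * n - 11 ≤ m →
      m ≤ ((n - 1) / 2) * ((n - 1) ⌈/⌉ 2) + 2 →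
      ∃ G : SimpleGraph (Fin n),
        IsSaturated K4Minus G ∧ ¬ G.IsBipartite ∧ G.edgeSet.ncard = m) ∧
    -- (c)
    (∀ n : ℕ, 10 ≤ n →
      edgeSpectrum n K4Minus =
        {3 * (n - 1) / 2} ∪
        Set.Icc (2 * n - 4) (((n - 1) / 2) * ((n - 1) ⌈/⌉ 2) + 2) ∪
        {m | ∃ i ∈ Set.Icc 2 (n - 2), m = i * (n - i)}) := by
  refine ⟨?_, fun n hn m h1 h2 => ?_, fun n hn => SimpleGraph.edgeSpectrum_k4Minus hn⟩
  · rintro V _ G n rfl hn hG hlt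
    exact SimpleGraph.isBipartite_of_isSaturated_of_lt hG hn hlt
  · exact SimpleGraph.exists_isSaturated_not_isBipartite hn h1 h2
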